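/- Let $C=(C_{ij}{}^k)_{i,j,k\in\{1,2\}}$ be real constants with $C_{ij}{}^k=C_{ji}{}^k$, and let $\nabla^C$ be the torsion free connection on $\mathbb{R}^+\times\mathbb{R}=\{(x^1,x^2):x^1>0\}$ with Christoffel symbols $\Gamma_{ij}{}^k=(x^1)^{-1}C_{ij}{}^k$, that is, $\nabla_{\partial_{x^i}}\partial_{x^j}=\sum_k\Gamma_{ij}{}^k\partial_{x^k}$. If $\nabla^C$ is not flat, i.e. if its curvature does not vanish identically, then $\mathcal{M}=(\mathbb{R}^+\times\mathbb{R},\nabla^C)$ is called a Type $\mathcal{B}$ surface. Two Type $\mathcal{B}$ surfaces are linearly equivalent if their connections are intertwined by a map $(x^1,x^2)\mapsto(x^1,ax^1+bx^2)$ with $a,b\in\mathbb{R}$, $b\ne0$. A torsion free connection $\nabla$ is strongly projectively flat if there are a flat torsion free connection $\tilde\nabla$ and a smooth closed $1$-form $\omega$, both defined on the whole surface, such that $\nabla_XY=\tilde\nabla_XY+\omega(X)Y+\omega(Y)X$ for all vector fields $X,Y$. A surface whose connection is not flat is also of Type $\mathcal{A}$ if it has an atlas of smooth coordinate charts in each of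 which the Christoffel symbols are constant. **Theorem 1.13.** Let $\mathcal{M}$ be a Type $\mathcal{B}$ surface. Then $\mathcal{M}$ is strongly projectively flat if and only if $\mathcal{M}$ is linearly equivalent to a Type $\mathcal{B}$ surface satisfying one of the following: 1. $C_{12}{}^1=C_{22}{}^1=C_{22}{}^2=0$; 2. $C_{11}{}^1=1+2v$, $C_{11}{}^2=0$, $C_{12}{}^1=0$, $C_{12}{}^2=v$, $C_{22}{}^1=\pm1$, $C_{22}{}^2=0$, for some $v\in\mathbb{R}$ and some choice of the sign. Moreover, a Type $\mathcal{B}$ surface satisfies the condition in (1) if and only if it is also of Type $\mathcal{A}$. -/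

import Mathlib

open scoped ContDiff

/-- The coordinate plane `ℝ²`; the coordinates `x¹, x²` of a point `x` are `x 0, x 1`. -/
abbrev Plane : Type := Fin 2 → ℝ

/-- The partial derivative `∂f/∂xⁱ` at `x`. -/
noncomputable def pderiv (i : Fin 2) (f : Plane → ℝ) (x : Plane) : ℝ :=
  fderiv ℝ f x (Pi.single i 1)

/-- Arrays `Γ i j k = Γ_{ij}{}^k` of Christoffel symbols at one point, relative to coordinates:
`∇_{∂_i} ∂_j = ∑ k, Γ i j k • ∂_k`. -/
abbrev Christoffel : Type := Fin 2 → Fin 2 → Fin 2 → ℝ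

/-- A smooth torsion free connection on the tangent bundle of a subset `U` of the plane (used for
`U` open), given by its Christoffel symbols. The values of `Γ` outside `U` play no role. -/
structure TorsionFreeConnection (U : Set Plane) where
  Γ : Plane → Christoffel
  smooth : ∀ i j k, ContDiffOn ℝ ∞ (fun x => Γ x i j k) U
  symm : ∀ x ∈ U, ∀ i j k, Γ x i j k = Γ x j i k

namespace TorsionFreeConnection

variable {U : Set Plane}

/-- The component `R_{ijk}{}^l` of the curvature operator
`R(X, Y) = ∇_X ∇_Y - ∇_Y ∇_X - ∇_{[X, Y]}`, that is,
`R(∂_i, ∂_j) ∂_k = ∑ l, R_{ijk}{}^l • ∂_l`. -/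
noncomputable def curvature (D : TorsionFreeConnection U) (x : Plane) (i j k l : Fin 2) : ℝ :=
  pderiv i (fun y => D.Γ y j k l) x - pderiv j (fun y => D.Γ y i k l) x
    + ∑ m, (D.Γ x i m l * D.Γ x j k m - D.Γ x j m l * D.Γ x i k m)

/-- The curvature operator vanishes identically on `U`. -/
def IsFlat (D : TorsionFreeConnection U) : Prop :=
  ∀ x ∈ U, ∀ i j k l, D.curvature x i j k l = 0

/-- Strong projective equivalence: there is a smooth closed 1-form `η = ∑ i, η i dxⁱ` on `U` with
`∇_X Y = ∇'_X Y + η(X) Y + η(Y) X` for all `X`, `Y`. -/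
def StronglyProjectivelyEquivalent (D D' : TorsionFreeConnection U) : Prop :=
  ∃ η : Plane → Fin 2 → ℝ,
    (∀ i, ContDiffOn ℝ ∞ (fun x => η x i) U) ∧
    (∀ x ∈ U, ∀ i j, pderiv i (fun y => η y j) x = pderiv j (fun y => η y i) x) ∧
    ∀ x ∈ U, ∀ i j k,
      D.Γ x i j k =
        D'.Γ x i j k + η x i * (if k = j then 1 else 0) + η x j * (if k = i then 1 else 0)

/-- Strongly projectively flat: strongly projectively equivalent to a flat connection. -/
def IsStronglyProjectivelyFlat (D : TorsionFreeConnection U) : Prop :=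
  ∃ D' : TorsionFreeConnection U, D'.IsFlat ∧ D.StronglyProjectivelyEquivalent D'

end TorsionFreeConnection

/-- The map `φ` intertwines, at the point `x`, the Christoffel symbols `G` at `x` with the
Christoffel symbols `G'` at `φ x`, i.e. `dφ(∇_X Y) = ∇'_{φ_* X} (φ_* Y)` at `φ x`. For a change of
coordinates `φ`, this is the transformation law of Christoffel symbols. -/
def Intertwines (φ : Plane → Plane) (x : Plane) (G G' : Christoffel) : Prop :=
  ∀ i j l,
    ∑ k, G i j k * pderiv k (fun y => φ y l) x =
      pderiv i (pderiv j (fun y => φ y l)) x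
        + ∑ a, ∑ b, G' a b l * pderiv i (fun y => φ y a) x * pderiv j (fun y => φ y b) x

/-- A connection defines a Type A surface: it is not flat, and there is an atlas of smooth
coordinate charts in each of which the Christoffel symbols are constant. -/
def TorsionFreeConnection.IsTypeA {U : Set Plane} (D : TorsionFreeConnection U) : Prop :=
  ¬ D.IsFlat ∧
    ∀ p ∈ U, ∃ φ : OpenPartialHomeomorph Plane Plane,
      p ∈ φ.source ∧ φ.source ⊆ U ∧
      ContDiffOn ℝ ∞ φ φ.source ∧ ContDiffOn ℝ ∞ φ.symm φ.target ∧
      ∃ G : Christoffel, ∀ x ∈ φ.source, Intertwines φ x (D.Γ x) G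

/-- The half plane `ℝ⁺ × ℝ`. -/
def halfPlane : Set Plane := {x | 0 < x 0}

/-- The connection `∇^C` on `ℝ⁺ × ℝ` with Christoffel symbols
`Γ_{ij}{}^k = (x¹)⁻¹ C_{ij}{}^k` for constants `C_{ij}{}^k = C_{ji}{}^k`. -/
noncomputable def typeBConnection (C : Christoffel) (hC : ∀ i j k, C i j k = C j i k) :
    TorsionFreeConnection halfPlane where
  Γ x i j k := (x 0)⁻¹ * C i j k
  smooth i j k := by
    refine ContDiffOn.mul (ContDiffOn.inv ?_ ?_) contDiffOn_const
    · exact (contDiff_apply ℝ ℝ (0 : Fin 2)).contDiffOn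
    · exact fun x hx => ne_of_gt hx
  symm x _ i j k := by rw [hC i j k]

/-- A Type B surface: the half plane `ℝ⁺ × ℝ` with a connection `∇^C` that is not flat.
The constants `C_{11}{}^1, C_{11}{}^2, C_{12}{}^1, …` are `C 0 0 0, C 0 0 1, C 0 1 0, …`. -/
structure TypeBSurface where
  C : Christoffel
  symm : ∀ i j k, C i j k = C j i k
  not_flat : ¬ (typeBConnection C symm).IsFlat

namespace TypeBSurface

/-- The connection `∇^C` of a Type B surface. -/
noncomputable def connection (M : TypeBSurface) : TorsionFreeConnection halfPlane :=
  typeBConnection M.C M.symm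

/-- Two Type B surfaces are linearly equivalent if their connections are intertwined by a map
`(x¹, x²) ↦ (x¹, a x¹ + b x²)` with `b ≠ 0` (a diffeomorphism of `ℝ⁺ × ℝ`). -/
def LinearlyEquivalent (M N : TypeBSurface) : Prop :=
  ∃ a b : ℝ, b ≠ 0 ∧ ∀ x ∈ halfPlane,
    Intertwines (fun y => ![y 0, a * y 0 + b * y 1]) x
      (M.connection.Γ x) (N.connection.Γ ![x 0, a * x 0 + b * x 1])

end TypeBSurface

/-!
A connection `∇^C` becomes flat after subtracting a closed 1-form `η` exactly if `η` solves an
equation expressing all `∂_i η_j` through `η` and the Ricci tensor `ρ` of `∇^C`. The integrability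
conditions of this equation are that `ρ` and `∇ρ` are totally symmetric. For `∇^C` these are
polynomial equations in the constants, `IsCodazzi`
(`IsCodazzi.of_isStronglyProjectivelyFlat`). If `C_{22}{}^1 = 0` they force
`C_{12}{}^1 = C_{22}{}^2 = 0` (`IsCodazzi.coeffs_eq_zero`); otherwise they leave, up to a shear and a
scaling, only the second family
(`TypeBSurface.exists_linearlyEquivalent_paraboloid`). Conversely, in both families subtracting
`C_{12}{}^2 dx¹ / x¹`, which is defined on the whole half plane and unchanged by linear equivalences,
gives a flat connection (`TypeBSurface.isStronglyProjectivelyFlat_of_linearlyEquivalent`).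

If `C_{12}{}^1 = C_{22}{}^1 = C_{22}{}^2 = 0`, a single chart `(log x¹, x² + g(x¹))` has constant
Christoffel symbols (`isTypeA_of_coeffs_eq_zero`). In the other direction, let `J` be the
differential of a chart with constant Christoffel symbols. The Ricci tensor has constant components
`r` in this chart, so `r(J_j, J_k) = (x¹)⁻² ρ_{jk}`. The conditions `IsCodazzi` hold for constant
Christoffel symbols and are invariant. Moreover `r`, where it is nondegenerate, is a flat
pseudometric; computing the Levi-Civita connection of `(x¹)⁻² ρ` and its curvature gives
`ρ_{22} det ρ = 0`, and a degenerate `r` is treated through its radical. Hence `ρ_{22} = 0`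
(`ConstantFrame.ricciConst_one_one`), and when `C_{22}{}^1 ≠ 0` this forces `∇^C` to be flat
(`IsCodazzi.flat_of_ricci`).
-/

/-! ### Partial derivatives -/

theorem isOpen_halfPlane : IsOpen halfPlane :=
  isOpen_lt continuous_const (continuous_apply 0)

section Calculus

variable {s : Set Plane} {f g : Plane → ℝ} {x : Plane}

theorem pderiv_congr_of_eqOn (hs : IsOpen s) (hfg : ∀ y ∈ s, f y = g y) (hx : x ∈ s) (i : Fin 2) :
    pderiv i f x = pderiv i g x := by
  have h : f =ᶠ[nhds x] g := Filter.eventually_of_mem (hs.mem_nhds hx) hfg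
  rw [pderiv, pderiv, h.fderiv_eq]

theorem pderiv_add (hf : DifferentiableAt ℝ f x) (hg : DifferentiableAt ℝ g x) (i : Fin 2) :
    pderiv i (fun y => f y + g y) x = pderiv i f x + pderiv i g x := by
  simp [pderiv, fderiv_fun_add hf hg]

theorem pderiv_sub (hf : DifferentiableAt ℝ f x) (hg : DifferentiableAt ℝ g x) (i : Fin 2) :
    pderiv i (fun y => f y - g y) x = pderiv i f x - pderiv i g x := by
  simp [pderiv, fderiv_fun_sub hf hg]

theorem pderiv_mul (hf : DifferentiableAt ℝ f x) (hg : DifferentiableAt ℝ g x) (i : Fin 2) :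
    pderiv i (fun y => f y * g y) x = pderiv i f x * g x + f x * pderiv i g x := by
  simp [pderiv, fderiv_fun_mul hf hg]; ring

theorem pderiv_const_mul (hf : DifferentiableAt ℝ f x) (c : ℝ) (i : Fin 2) :
    pderiv i (fun y => c * f y) x = c * pderiv i f x := by
  simp [pderiv, fderiv_const_mul hf c]

theorem pderiv_const (c : ℝ) (i : Fin 2) : pderiv i (fun _ => c) x = 0 := by
  simp [pderiv]

theorem pderiv_coord (i k : Fin 2) : pderiv i (fun y => y k) x = if i = k then 1 else 0 := by
  have h : HasFDerivAt (fun y : Plane => y k) (ContinuousLinearMap.proj (R := ℝ) k) x :=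
    (ContinuousLinearMap.proj (R := ℝ) (φ := fun _ : Fin 2 => ℝ) k).hasFDerivAt
  rw [pderiv, h.fderiv]
  simp [Pi.single_apply, eq_comm]

theorem hasFDerivAt_comp_fst {h : ℝ → ℝ} {h' : ℝ} (hh : HasDerivAt h h' (x 0)) :
    HasFDerivAt (fun y : Plane => h (y 0)) (h' • ContinuousLinearMap.proj (R := ℝ) 0) x :=
  hh.comp_hasFDerivAt x
    (ContinuousLinearMap.proj (R := ℝ) (φ := fun _ : Fin 2 => ℝ) 0).hasFDerivAt

theorem pderiv_comp_fst {h : ℝ → ℝ} {h' : ℝ} (hh : HasDerivAt h h' (x 0)) (i : Fin 2) :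
    pderiv i (fun y => h (y 0)) x = if i = 0 then h' else 0 := by
  rw [pderiv, (hasFDerivAt_comp_fst hh).fderiv]
  simp [Pi.single_apply, eq_comm]

theorem differentiableAt_inv_fst (hx : x ∈ halfPlane) :
    DifferentiableAt ℝ (fun y : Plane => (y 0)⁻¹) x :=
  (hasFDerivAt_comp_fst (hasDerivAt_inv (ne_of_gt hx))).differentiableAt

theorem pderiv_inv_fst (hx : x ∈ halfPlane) (i : Fin 2) :
    pderiv i (fun y => (y 0)⁻¹) x = if i = 0 then -(x 0)⁻¹ ^ 2 else 0 := by
  rw [pderiv_comp_fst (h := fun t => t⁻¹) (hasDerivAt_inv (ne_of_gt hx))]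
  simp

theorem differentiableAt_of_smoothOn (hs : IsOpen s) (hf : ContDiffOn ℝ ∞ f s) (hx : x ∈ s) :
    DifferentiableAt ℝ f x :=
  (hf.contDiffAt (hs.mem_nhds hx)).differentiableAt (by simp)

theorem contDiffOn_pderiv (hs : IsOpen s) (hf : ContDiffOn ℝ ∞ f s) (i : Fin 2) :
    ContDiffOn ℝ ∞ (pderiv i f) s :=
  (hf.fderiv_of_isOpen hs (by simp)).clm_apply contDiffOn_const

theorem pderiv_comm (hs : IsOpen s) (hf : ContDiffOn ℝ ∞ f s) (hx : x ∈ s) (i j : Fin 2) :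
    pderiv i (pderiv j f) x = pderiv j (pderiv i f) x := by
  have hfx := hf.contDiffAt (hs.mem_nhds hx)
  have h2 : DifferentiableAt ℝ (fderiv ℝ f) x :=
    (hfx.fderiv_right (m := 1) (by norm_cast)).differentiableAt (by simp)
  have key : ∀ i j : Fin 2, pderiv i (pderiv j f) x =
      fderiv ℝ (fderiv ℝ f) x (Pi.single i 1) (Pi.single j 1) := fun i j => by
    unfold pderiv
    rw [fderiv_clm_apply h2 (differentiableAt_const _)]
    simp
  rw [key, key]
  exact (hfx.isSymmSndFDerivAt (by simpa using by norm_cast)).eq _ _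

end Calculus

/-! ### Curvature of the connections with constants `C` -/

/-- The constants `R_{ijk}{}^l` with `curvature = (x¹)⁻² R_{ijk}{}^l` for the connection `∇^C`; the
first two terms come from differentiating `(x¹)⁻¹`. -/
def curvConst (C : Christoffel) (i j k l : Fin 2) : ℝ :=
  (if j = 0 then C i k l else 0) - (if i = 0 then C j k l else 0)
    + ∑ m, (C i m l * C j k m - C j m l * C i k m)

/-- The constants `ρ_{jk} = ∑ i, R_{ijk}{}^i`; the Ricci tensor of `∇^C` is `(x¹)⁻² ρ_{jk}`. It is
not assumed to be symmetric. -/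
def ricciConst (C : Christoffel) (j k : Fin 2) : ℝ := ∑ i, curvConst C i j k i

/-- The algebraic form of the two local obstructions to strong projective flatness of `∇^C`:
`trace` says that the Ricci tensor is symmetric, and `cotton` that
`(∇_{∂₁} ρ)(∂₂, ∂_k) = (∇_{∂₂} ρ)(∂₁, ∂_k)`, that is, `∇ρ` is totally symmetric. -/
structure IsCodazzi (C : Christoffel) : Prop where
  trace : C 0 1 0 + C 1 1 1 = 0
  cotton : ∀ k, -2 * ricciConst C 1 k - ∑ l, C 0 k l * ricciConst C 1 l
    + ∑ l, C 1 k l * ricciConst C 0 l = 0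

theorem curvature_typeBConnection (C : Christoffel) (hC : ∀ i j k, C i j k = C j i k) {x : Plane}
    (hx : x ∈ halfPlane) (i j k l : Fin 2) :
    (typeBConnection C hC).curvature x i j k l = (x 0)⁻¹ ^ 2 * curvConst C i j k l := by
  have h : ∀ (i : Fin 2) (c : ℝ), pderiv i (fun y : Plane => (y 0)⁻¹ * c) x =
      (if i = 0 then -(x 0)⁻¹ ^ 2 else 0) * c := fun i c => by
    rw [pderiv_mul (differentiableAt_inv_fst hx) (differentiableAt_const _), pderiv_inv_fst hx,
      pderiv_const]
    ring
  simp only [TorsionFreeConnection.curvature, typeBConnection, h, curvConst, Fin.sum_univ_two]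
  split_ifs <;> ring

/-- In dimension two the curvature is determined by the Ricci tensor. -/
theorem isFlat_typeBConnection_iff (C : Christoffel) (hC : ∀ i j k, C i j k = C j i k) :
    (typeBConnection C hC).IsFlat ↔ ∀ j k, ricciConst C j k = 0 := by
  have h1 : (typeBConnection C hC).IsFlat ↔ ∀ i j k l, curvConst C i j k l = 0 := by
    constructor
    · intro h i j k l
      have hx : (fun _ => 1 : Plane) ∈ halfPlane := by simp [halfPlane]
      simpa [curvature_typeBConnection C hC hx] using h _ hx i j k l
    · intro h x hx i j k l
      rw [curvature_typeBConnection C hC hx, h, mul_zero]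
  rw [h1]
  constructor
  · intro h j k
    simp [ricciConst, h]
  · intro h
    have key : ∀ k, curvConst C 0 1 k 0 = 0 ∧ curvConst C 0 1 k 1 = 0 := fun k => by
      have h0 := h 0 k
      have h1 := h 1 k
      simp only [ricciConst, curvConst, Fin.sum_univ_two, Fin.isValue, if_true, one_ne_zero,
        if_false] at h0 h1 ⊢
      constructor <;> linarith
    intro i j k l
    have h0 := (key k).1
    have h1 := (key k).2
    fin_cases i <;> fin_cases j <;> fin_cases l <;>
      simp only [curvConst, Fin.sum_univ_two, Fin.isValue, Fin.zero_eta, Fin.mk_one, if_true,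
        one_ne_zero, if_false] at h0 h1 ⊢ <;> linarith

theorem ricciConst_formulas {C : Christoffel} (hC : ∀ i j k, C i j k = C j i k) :
    ricciConst C 0 0 = C 0 1 1 * (1 + C 0 0 0 - C 0 1 1) + C 0 0 1 * (C 1 1 1 - C 0 1 0) ∧
    ricciConst C 0 1 = C 1 1 1 + C 0 1 0 * C 0 1 1 - C 0 0 1 * C 1 1 0 ∧
    ricciConst C 1 0 = -C 0 1 0 + C 0 1 0 * C 0 1 1 - C 0 0 1 * C 1 1 0 ∧
    ricciConst C 1 1 = C 1 1 0 * (C 0 0 0 - 1 - C 0 1 1) + C 0 1 0 * (C 1 1 1 - C 0 1 0) := by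
  simp only [ricciConst, curvConst, Fin.sum_univ_two, Fin.isValue, if_true, one_ne_zero,
        if_false, hC 1 0]
  refine ⟨?_, ?_, ?_, ?_⟩ <;> ring

theorem IsCodazzi.coeffs_eq_zero {C : Christoffel} (hC : ∀ i j k, C i j k = C j i k)
    (h : IsCodazzi C) (hG : C 1 1 0 = 0) : C 0 1 0 = 0 ∧ C 1 1 1 = 0 := by
  obtain ⟨h00, h01, h10, h11⟩ := ricciConst_formulas hC
  have hH : C 1 1 1 = -C 0 1 0 := by linarith [h.trace]
  have h1 := h.cotton 1
  simp only [Fin.sum_univ_two, h00, h01, h10, h11, hG, hH] at h1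
  have : C 0 1 0 = 0 := by
    have : C 0 1 0 ^ 2 = 0 := by linarith
    simpa using this
  simp [hH, this]

/-- If `C_{22}{}^1 ≠ 0`, these relations say that the shear which kills `C_{12}{}^1` makes
`C_{11}{}^1 = 1 + 2 C_{12}{}^2` and `C_{11}{}^2 = 0`. -/
theorem IsCodazzi.relations {C : Christoffel} (hC : ∀ i j k, C i j k = C j i k)
    (h : IsCodazzi C) :
    C 1 1 0 * (C 0 0 0 - 1 - 2 * C 0 1 1) = 3 * C 0 1 0 ^ 2 ∧
    C 1 1 0 * (C 0 1 0 * C 0 0 0 + C 0 0 1 * C 1 1 0 - 2 * C 0 1 0 * C 0 1 1)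
      = 2 * C 0 1 0 ^ 3 := by
  obtain ⟨h00, h01, h10, h11⟩ := ricciConst_formulas hC
  have hH : C 1 1 1 = -C 0 1 0 := by linarith [h.trace]
  have h0 := h.cotton 0
  have h1 := h.cotton 1
  simp only [Fin.sum_univ_two, h00, h01, h10, h11, hC 1 0, hH] at h0 h1
  have e : C 1 1 0 * (C 0 0 0 - 1 - 2 * C 0 1 1) = 3 * C 0 1 0 ^ 2 := by linarith
  refine ⟨e, ?_⟩
  linear_combination C 1 1 0 / 3 * h0 + 2 * C 0 1 0 / 3 * e

/-- If `C_{22}{}^1 ≠ 0`, the component `ρ_{22}` of the Ricci tensor decides flatness. -/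
theorem IsCodazzi.flat_of_ricci {C : Christoffel} (hC : ∀ i j k, C i j k = C j i k)
    (h : IsCodazzi C) (hG : C 1 1 0 ≠ 0) (h11 : ricciConst C 1 1 = 0) (j k : Fin 2) :
    ricciConst C j k = 0 := by
  obtain ⟨h00, h01, h10, h11'⟩ := ricciConst_formulas hC
  have hH : C 1 1 1 = -C 0 1 0 := by linarith [h.trace]
  have hs : ricciConst C 1 0 = ricciConst C 0 1 := by rw [h10, h01, hH]
  have h0 := h.cotton 0
  have h1 := h.cotton 1
  simp only [Fin.sum_univ_two, hC 1 0, h11, hs, hH] at h0 h1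
  rw [h11, hH] at h11'
  have z1 : ricciConst C 0 1 = 0 := by
    have : C 1 1 0 * ricciConst C 0 1 = 0 := by
      linear_combination (-1/3) * (C 1 1 0 * h0 - C 0 1 0 * h1 - ricciConst C 0 1 * h11')
    simpa [hG] using this
  have z0 : ricciConst C 0 0 = 0 := by
    have : C 1 1 0 * ricciConst C 0 0 = 0 := by
      linear_combination h1 + 2 * C 0 1 0 * z1
    simpa [hG] using this
  fin_cases j <;> fin_cases k <;> simp [z0, z1, hs, h11]

/-! ### Strong projective flatness -/

/-- The constants of the connection obtained from `∇^C` by subtracting `ω ⊗ id + id ⊗ ω` for the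
closed 1-form `ω = c dx¹ / x¹`. -/
def shiftConst (C : Christoffel) (c : ℝ) : Christoffel := fun i j k =>
  C i j k - (if i = 0 then if k = j then c else 0 else 0)
    - if j = 0 then if k = i then c else 0 else 0

theorem shiftConst_symm {C : Christoffel} (hC : ∀ i j k, C i j k = C j i k) (c : ℝ)
    (i j k : Fin 2) : shiftConst C c i j k = shiftConst C c j i k := by
  simp only [shiftConst, hC i j k]; ring

theorem isStronglyProjectivelyFlat_of_shift {C : Christoffel} (hC : ∀ i j k, C i j k = C j i k)
    (c : ℝ) (h : ∀ j k, ricciConst (shiftConst C c) j k = 0) :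
    (typeBConnection C hC).IsStronglyProjectivelyFlat := by
  refine ⟨typeBConnection (shiftConst C c) (shiftConst_symm hC c),
    (isFlat_typeBConnection_iff _ _).2 h, fun x i => if i = 0 then (x 0)⁻¹ * c else 0, ?_, ?_, ?_⟩
  · intro i
    beta_reduce
    split_ifs
    · exact (ContDiffOn.inv (contDiff_apply ℝ ℝ (0 : Fin 2)).contDiffOn
        fun x hx => ne_of_gt hx).mul contDiffOn_const
    · exact contDiffOn_const
  · intro x hx i j
    have h0 : ∀ i, pderiv i (fun y : Plane => (y 0)⁻¹ * c) x =
        (if i = 0 then -(x 0)⁻¹ ^ 2 else 0) * c := fun i => by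
      rw [pderiv_mul (differentiableAt_inv_fst hx) (differentiableAt_const _), pderiv_inv_fst hx,
        pderiv_const]
      ring
    fin_cases i <;> fin_cases j <;> simp [h0, pderiv_const]
  · intro x hx i j k
    simp only [typeBConnection, shiftConst]
    split_ifs <;> ring

/-- The integrability conditions of the equation for a closed form `η` that makes `∇^C - η` flat. -/
theorem IsCodazzi.of_isStronglyProjectivelyFlat {C : Christoffel}
    (hC : ∀ i j k, C i j k = C j i k)
    (h : (typeBConnection C hC).IsStronglyProjectivelyFlat) : IsCodazzi C := by
  obtain ⟨D, hD, η, hη, hclosed, hDη⟩ := h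
  have hΓ : ∀ y ∈ halfPlane, ∀ i j k, D.Γ y i j k = (y 0)⁻¹ * C i j k
      - (if k = j then η y i else 0) - if k = i then η y j else 0 := fun y hy i j k => by
    have := hDη y hy i j k
    simp only [typeBConnection] at this
    rw [this]
    split_ifs <;> ring
  have hηd : ∀ y ∈ halfPlane, ∀ i, DifferentiableAt ℝ (fun y => η y i) y := fun y hy i =>
    differentiableAt_of_smoothOn isOpen_halfPlane (hη i) hy
  have hΓd : ∀ y ∈ halfPlane, ∀ l i j k, pderiv l (fun z => D.Γ z i j k) y =
      (if l = 0 then -(y 0)⁻¹ ^ 2 else 0) * C i j k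
      - (if k = j then pderiv l (fun z => η z i) y else 0)
      - if k = i then pderiv l (fun z => η z j) y else 0 := fun y hy l i j k => by
    have d0 := differentiableAt_inv_fst hy
    have d1 := hηd y hy i
    have d2 := hηd y hy j
    rw [pderiv_congr_of_eqOn isOpen_halfPlane (fun z hz => hΓ z hz i j k) hy]
    split_ifs <;>
      simp (disch := fun_prop) only [pderiv_sub, pderiv_mul, pderiv_const, pderiv_inv_fst hy,
        mul_zero, add_zero] <;> simp [*]
  -- flatness of `D` is a Riccati equation for `η`: it determines all its first derivatives
  have hess : ∀ y ∈ halfPlane, C 0 1 0 + C 1 1 1 = 0 ∧ ∀ i j, pderiv i (fun z => η z j) y =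
      -((y 0)⁻¹ ^ 2 * ricciConst C i j) + (y 0)⁻¹ * ∑ k, C i j k * η y k - η y i * η y j := by
    intro y hy
    have c := hclosed y hy 1 0
    have e00 := hD y hy 0 1 0 0
    have e01 := hD y hy 0 1 0 1
    have e10 := hD y hy 0 1 1 0
    have e11 := hD y hy 0 1 1 1
    simp only [TorsionFreeConnection.curvature, hΓ y hy, hΓd y hy, Fin.sum_univ_two, Fin.isValue,
      if_true, one_ne_zero, zero_ne_one, if_false, hC 1 0] at e00 e01 e10 e11
    obtain ⟨h00, h01, h10, h11⟩ := ricciConst_formulas hC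
    have y0 : (y 0)⁻¹ ≠ 0 := inv_ne_zero (ne_of_gt hy)
    have tr : C 0 1 0 + C 1 1 1 = 0 := by
      have : (y 0)⁻¹ ^ 2 * (C 0 1 0 + C 1 1 1) = 0 := by
        linear_combination -e00 - e11 + 3 * c
      exact (mul_eq_zero.1 this).resolve_left (pow_ne_zero 2 y0)
    have hH : C 1 1 1 = -C 0 1 0 := by linarith
    refine ⟨tr, fun i j => ?_⟩
    simp only [hH] at e00 e01 e10 e11 h00 h01 h11
    fin_cases i <;> fin_cases j <;>
      simp only [Fin.sum_univ_two, Fin.isValue, Fin.zero_eta, Fin.mk_one, hC 1 0, hH,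
        h00, h01, h10, h11]
    · linear_combination -e01
    · linear_combination -e11 + c
    · linear_combination -e11 + 2 * c
    · linear_combination e10
  -- equating the mixed second derivatives of `η` eliminates `η` and leaves the Cotton condition
  have hess2 : ∀ y ∈ halfPlane, ∀ l i j, pderiv l (pderiv i (fun z => η z j)) y =
      (if l = 0 then -(y 0)⁻¹ ^ 2 else 0) *
        (-(2 * (y 0)⁻¹ * ricciConst C i j) + ∑ k, C i j k * η y k)
      + (y 0)⁻¹ * ∑ k, C i j k * pderiv l (fun z => η z k) y
      - (pderiv l (fun z => η z i) y * η y j + η y i * pderiv l (fun z => η z j) y) := by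
    intro y hy l i j
    have d0 := differentiableAt_inv_fst hy
    have d := hηd y hy
    have d1 := d 0
    have d2 := d 1
    have d3 := d i
    have d4 := d j
    rw [pderiv_congr_of_eqOn isOpen_halfPlane (fun z hz => (hess z hz).2 i j) hy]
    have e : (fun z : Plane => -((z 0)⁻¹ ^ 2 * ricciConst C i j) +
        (z 0)⁻¹ * ∑ k, C i j k * η z k - η z i * η z j) = fun z : Plane =>
        (z 0)⁻¹ * (z 0)⁻¹ * -ricciConst C i j +
        (z 0)⁻¹ * (C i j 0 * η z 0 + C i j 1 * η z 1) - η z i * η z j := by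
      funext z; simp only [Fin.sum_univ_two]; ring
    rw [e]
    simp (disch := fun_prop) only [pderiv_add, pderiv_sub, pderiv_mul, pderiv_const,
      pderiv_inv_fst hy, Fin.sum_univ_two]
    ring
  have hx : (fun _ => 1 : Plane) ∈ halfPlane := by simp [halfPlane]
  obtain ⟨tr, h1⟩ := hess _ hx
  refine ⟨tr, fun k => ?_⟩
  have hH : C 1 1 1 = -C 0 1 0 := by linarith
  have hs : ricciConst C 1 0 = ricciConst C 0 1 := by
    obtain ⟨h00, h01, h10, h11⟩ := ricciConst_formulas hC
    rw [h10, h01, hH]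
  obtain ⟨h00, h01, -, h11⟩ := ricciConst_formulas hC
  have hc := pderiv_comm isOpen_halfPlane (hη k) hx 0 1
  rw [hess2 _ hx, hess2 _ hx] at hc
  fin_cases k <;>
    simp only [Fin.sum_univ_two, h1, Fin.isValue, if_true, one_ne_zero, if_false, hC 1 0, hs, hH,
      Fin.zero_eta, Fin.mk_one, inv_one, h00, h01, h11] at hc ⊢ <;>
    linear_combination -hc

/-! ### Linear equivalence and normal forms -/

/-- The Jacobian of `(x¹, x²) ↦ (x¹, a x¹ + b x²)`: the entry `j l` is the `j`-th partial
derivative of the `l`-th component. -/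
def shearJacobian (a b : ℝ) : Fin 2 → Fin 2 → ℝ := ![![1, a], ![0, b]]

theorem pderiv_shear (a b : ℝ) (j l : Fin 2) :
    pderiv j (fun y : Plane => (![y 0, a * y 0 + b * y 1] : Plane) l) =
      fun _ => shearJacobian a b j l := by
  funext x
  have d0 : DifferentiableAt ℝ (fun y : Plane => y 0) x := by fun_prop
  have d1 : DifferentiableAt ℝ (fun y : Plane => y 1) x := by fun_prop
  fin_cases l
  · simp only [Fin.zero_eta, Fin.isValue, Matrix.cons_val_zero, pderiv_coord]
    fin_cases j <;> simp [shearJacobian]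
  · simp only [Fin.mk_one, Fin.isValue, Matrix.cons_val_one, Matrix.cons_val_zero]
    rw [pderiv_add (d0.const_mul a) (d1.const_mul b), pderiv_const_mul d0, pderiv_const_mul d1,
      pderiv_coord, pderiv_coord]
    fin_cases j <;> simp [shearJacobian]

namespace TypeBSurface

theorem linearlyEquivalent_iff (M N : TypeBSurface) :
    M.LinearlyEquivalent N ↔ ∃ a b : ℝ, b ≠ 0 ∧ ∀ i j l,
      ∑ k, M.C i j k * shearJacobian a b k l =
        ∑ p, ∑ q, N.C p q l * shearJacobian a b i p * shearJacobian a b j q := by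
  have key : ∀ (a b : ℝ), ∀ x ∈ halfPlane,
      (Intertwines (fun y => ![y 0, a * y 0 + b * y 1]) x
        (M.connection.Γ x) (N.connection.Γ ![x 0, a * x 0 + b * x 1]) ↔ ∀ i j l,
      ∑ k, M.C i j k * shearJacobian a b k l =
        ∑ p, ∑ q, N.C p q l * shearJacobian a b i p * shearJacobian a b j q) := by
    intro a b x hx
    have h0 : (x 0)⁻¹ ≠ 0 := inv_ne_zero (ne_of_gt hx)
    simp only [Intertwines, pderiv_shear, pderiv_const, zero_add]
    refine forall_congr' fun i => forall_congr' fun j => forall_congr' fun l => ?_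
    conv_rhs => rw [← mul_right_inj' h0]
    simp only [connection, typeBConnection, Matrix.cons_val_zero, Finset.mul_sum, mul_assoc]
  constructor
  · rintro ⟨a, b, hb, h⟩
    have hx : (fun _ => 1 : Plane) ∈ halfPlane := by simp [halfPlane]
    exact ⟨a, b, hb, (key a b _ hx).1 (h _ hx)⟩
  · rintro ⟨a, b, hb, h⟩
    exact ⟨a, b, hb, fun x hx => (key a b x hx).2 h⟩

theorem linearlyEquivalent_refl (M : TypeBSurface) : M.LinearlyEquivalent M := by
  refine M.linearlyEquivalent_iff M |>.2 ⟨0, 1, one_ne_zero, fun i j l => ?_⟩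
  fin_cases i <;> fin_cases j <;> fin_cases l <;> simp [shearJacobian, Fin.sum_univ_two]

/-- Shears preserve `dx¹ / x¹`, so the 1-form that flattens a normal form (`C_{12}{}^2 dx¹ / x¹` in
both cases) also flattens every linearly equivalent surface. -/
theorem isStronglyProjectivelyFlat_of_linearlyEquivalent {M N : TypeBSurface}
    (hMN : M.LinearlyEquivalent N)
    (hN : (N.C 0 1 0 = 0 ∧ N.C 1 1 0 = 0 ∧ N.C 1 1 1 = 0) ∨
      ∃ v : ℝ, N.C 0 0 0 = 1 + 2 * v ∧ N.C 0 0 1 = 0 ∧ N.C 0 1 0 = 0 ∧ N.C 0 1 1 = v ∧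
        (N.C 1 1 0 = 1 ∨ N.C 1 1 0 = -1) ∧ N.C 1 1 1 = 0) :
    M.connection.IsStronglyProjectivelyFlat := by
  obtain ⟨a, b, hb, h⟩ := (linearlyEquivalent_iff M N).1 hMN
  have h000 := h 0 0 0
  have h001 := h 0 0 1
  have h010 := h 0 1 0
  have h011 := h 0 1 1
  have h110 := h 1 1 0
  have h111 := h 1 1 1
  simp only [shearJacobian, Fin.sum_univ_two, Matrix.cons_val_zero, Matrix.cons_val_one,
    N.symm 1 0, Fin.isValue] at h000 h001 h010 h011 h110 h111
  suffices ∃ c, ∀ j k, ricciConst (shiftConst M.C c) j k = 0 by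
    obtain ⟨c, hc⟩ := this
    exact isStronglyProjectivelyFlat_of_shift M.symm c hc
  have cancel : ∀ (c : ℝ) (_ : ∀ j k, b * ricciConst (shiftConst M.C c) j k = 0),
      ∀ j k, ricciConst (shiftConst M.C c) j k = 0 := fun c hc j k =>
    (mul_eq_zero.1 (hc j k)).resolve_left hb
  rcases hN with ⟨h1, h2, h3⟩ | ⟨v, h0, h1, h2, h3, -, h4⟩
  · have e1 : M.C 0 1 0 = 0 := by linear_combination h010 + b * h1 + a * b * h2
    have e2 : M.C 1 1 0 = 0 := by linear_combination h110 + b ^ 2 * h2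
    have e3 : M.C 1 1 1 = 0 := by
      have : b * M.C 1 1 1 = 0 := by linear_combination h111 + b ^ 2 * h3 - a * e2
      simpa [hb] using this
    refine ⟨M.C 0 1 1, fun j k => ?_⟩
    obtain ⟨r00, r01, r10, r11⟩ := ricciConst_formulas (shiftConst_symm M.symm (M.C 0 1 1))
    fin_cases j <;> fin_cases k <;> simp [r00, r01, r10, r11, shiftConst, e1, e2, e3]
  · have e0 : M.C 0 0 0 = 1 + 2 * v + a ^ 2 * N.C 1 1 0 := by
      linear_combination h000 + h0 + 2 * a * h2
    have e1 : M.C 0 1 0 = a * b * N.C 1 1 0 := by linear_combination h010 + b * h2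
    have e2 : M.C 1 1 0 = b ^ 2 * N.C 1 1 0 := by linear_combination h110
    have e3 : M.C 1 1 1 = - a * b * N.C 1 1 0 := by
      have : b * (M.C 1 1 1 + a * b * N.C 1 1 0) = 0 := by
        linear_combination h111 + b ^ 2 * h4 - a * e2
      linear_combination (mul_eq_zero.1 this).resolve_left hb
    have e4 : M.C 0 1 1 = v - a ^ 2 * N.C 1 1 0 := by
      have : b * (M.C 0 1 1 - v + a ^ 2 * N.C 1 1 0) = 0 := by
        linear_combination h011 + b * h3 + a * b * h4 - a * e1
      linear_combination (mul_eq_zero.1 this).resolve_left hb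
    have e5 : b * M.C 0 0 1 = - a * (1 + a ^ 2 * N.C 1 1 0) := by
      linear_combination h001 + h1 + 2 * a * h3 + a ^ 2 * h4 - a * e0
    refine ⟨v, cancel v fun j k => ?_⟩
    obtain ⟨r00, r01, r10, r11⟩ := ricciConst_formulas (shiftConst_symm M.symm v)
    fin_cases j <;> fin_cases k <;>
      simp only [r00, r01, r10, r11, shiftConst, Fin.isValue, Fin.zero_eta, Fin.mk_one, if_true,
        one_ne_zero, zero_ne_one, if_false, e0, e1, e2, e3, e4]
    · linear_combination (-2 * a * b * N.C 1 1 0) * e5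
    · linear_combination (-b ^ 2 * N.C 1 1 0) * e5
    · linear_combination (-b ^ 2 * N.C 1 1 0) * e5
    · ring

end TypeBSurface

/-- The constants of the second normal form. After subtracting `v dx¹ / x¹` the connection is flat,
with affine coordinates `x²` and `(x¹)² + ε (x²)²`. -/
def paraboloidConst (v ε : ℝ) : Christoffel :=
  ![![![1 + 2 * v, 0], ![0, v]], ![![0, v], ![ε, 0]]]

theorem paraboloidConst_symm (v ε : ℝ) (i j k : Fin 2) :
    paraboloidConst v ε i j k = paraboloidConst v ε j i k := by
  fin_cases i <;> fin_cases j <;> simp [paraboloidConst]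

/-- If `C_{22}{}^1 ≠ 0`, a shear kills `C_{12}{}^1` and a scaling makes `C_{22}{}^1 = ±1`; the
remaining constants are then forced. -/
theorem TypeBSurface.exists_linearlyEquivalent_paraboloid (M : TypeBSurface) (h : IsCodazzi M.C)
    (hG : M.C 1 1 0 ≠ 0) :
    ∃ N : TypeBSurface, M.LinearlyEquivalent N ∧
      ∃ v : ℝ, N.C 0 0 0 = 1 + 2 * v ∧ N.C 0 0 1 = 0 ∧ N.C 0 1 0 = 0 ∧ N.C 0 1 1 = v ∧
        (N.C 1 1 0 = 1 ∨ N.C 1 1 0 = -1) ∧ N.C 1 1 1 = 0 := by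
  obtain ⟨e1, e2⟩ := h.relations M.symm
  have hH : M.C 1 1 1 = -M.C 0 1 0 := by linarith [h.trace]
  -- the scaling `b` normalizes `C_{22}{}^1`, the shear `a` below kills `C_{12}{}^1`
  obtain ⟨ε, b, hb, hε, hbG⟩ : ∃ ε b : ℝ, b ≠ 0 ∧ (ε = 1 ∨ ε = -1) ∧ M.C 1 1 0 = b ^ 2 * ε := by
    rcases lt_or_gt_of_ne hG with hlt | hgt
    · refine ⟨-1, √(-M.C 1 1 0), (Real.sqrt_pos.2 (by linarith)).ne', Or.inr rfl, ?_⟩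
      rw [Real.sq_sqrt (by linarith)]; ring
    · refine ⟨1, √(M.C 1 1 0), (Real.sqrt_pos.2 hgt).ne', Or.inl rfl, ?_⟩
      rw [Real.sq_sqrt hgt.le]; ring
  have hε2 : ε ^ 2 = 1 := by rcases hε with rfl | rfl <;> norm_num
  obtain ⟨a, haG⟩ : ∃ a, a * M.C 1 1 0 = b * M.C 0 1 0 :=
    ⟨b * M.C 0 1 0 / M.C 1 1 0, by field_simp⟩
  have hE : M.C 0 1 0 = a * b * ε := by
    apply mul_left_cancel₀ hb
    rw [← haG, hbG]; ring
  obtain ⟨v, hv⟩ : ∃ v, M.C 0 1 1 = v - a ^ 2 * ε := ⟨M.C 0 1 1 + a ^ 2 * ε, by ring⟩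
  have hε0 : ε ≠ 0 := by rintro rfl; norm_num at hε2
  have hA : M.C 0 0 0 = 1 + 2 * v + a ^ 2 * ε := by
    apply mul_left_cancel₀ hG
    rw [hE, hbG, hv] at e1
    rw [hbG]
    linear_combination e1
  have hB : b * M.C 0 0 1 = - a * (1 + a ^ 2 * ε) := by
    apply mul_left_cancel₀ (mul_ne_zero hG (mul_ne_zero hε0 hb))
    rw [hE, hbG, hv, hA] at e2
    rw [hbG]
    linear_combination e2
  refine ⟨⟨paraboloidConst v ε, paraboloidConst_symm v ε, fun hflat => M.not_flat ?_⟩, ?_, v, ?_⟩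
  · rw [isFlat_typeBConnection_iff] at hflat ⊢
    apply h.flat_of_ricci M.symm hG
    have f11 := (ricciConst_formulas (paraboloidConst_symm v ε)).2.2.2.symm.trans (hflat 1 1)
    rw [(ricciConst_formulas M.symm).2.2.2]
    simp only [paraboloidConst, Matrix.cons_val_zero, Matrix.cons_val_one, Fin.isValue] at f11
    rw [hE, hbG, hv, hA, hH, hE]
    linear_combination b ^ 2 * f11
  · refine (TypeBSurface.linearlyEquivalent_iff _ _).2 ⟨a, b, hb, fun i j l => ?_⟩
    fin_cases i <;> fin_cases j <;> fin_cases l <;>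
      simp only [shearJacobian, paraboloidConst, Fin.sum_univ_two, M.symm 1 0, hbG, hE, hv, hA, hH,
        Matrix.cons_val_zero, Matrix.cons_val_one, Fin.isValue, Fin.zero_eta, Fin.mk_one] <;>
      first | ring1 | linear_combination hB
  · simpa [paraboloidConst] using hε

/-! ### Charts with constant Christoffel symbols -/

/-- A solution of `g'' = (κ g' + B) / t` on `t > 0`: a linear one if `κ ≠ 0`, and
`B t log t` in the resonant case `κ = 0`. -/
theorem exists_shear_profile (κ B : ℝ) : ∃ g g₁ : ℝ → ℝ,
    ContDiffOn ℝ ∞ g (Set.Ioi 0) ∧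
    ∀ t, 0 < t → HasDerivAt g (g₁ t) t ∧ HasDerivAt g₁ (t⁻¹ * (κ * g₁ t + B)) t := by
  by_cases hκ : κ = 0
  · refine ⟨fun t => B * (t * Real.log t), fun t => B * (Real.log t + 1), ?_, fun t ht => ?_⟩
    · refine contDiffOn_const.mul (contDiffOn_id.mul ?_)
      exact Real.contDiffOn_log.mono fun t ht => ne_of_gt ht
    · constructor
      · exact (Real.hasDerivAt_mul_log ht.ne').const_mul B
      · refine (((Real.hasDerivAt_log ht.ne').add_const 1).const_mul B).congr_deriv ?_
        rw [hκ]; ring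
  · refine ⟨fun t => -(B / κ) * t, fun _ => -(B / κ), ?_, fun t ht => ⟨?_, ?_⟩⟩
    · exact contDiffOn_const.mul contDiffOn_id
    · simpa using (hasDerivAt_id t).const_mul (-(B / κ))
    · refine (hasDerivAt_const t (-(B / κ))).congr_deriv ?_
      field_simp; ring

/-- The chart `(x¹, x²) ↦ (log x¹, x² + g(x¹))` of the half plane, with image the whole plane. -/
noncomputable def logChart (g : ℝ → ℝ) (hg : ContinuousOn g (Set.Ioi 0)) :
    OpenPartialHomeomorph Plane Plane where
  toFun x := ![Real.log (x 0), x 1 + g (x 0)]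
  invFun u := ![Real.exp (u 0), u 1 - g (Real.exp (u 0))]
  source := halfPlane
  target := Set.univ
  map_source' _ _ := Set.mem_univ _
  map_target' u _ := by simp [halfPlane, Real.exp_pos]
  left_inv' x hx := by
    have h : (0 : ℝ) < x 0 := hx
    ext i; fin_cases i <;> simp [Real.exp_log h]
  right_inv' u _ := by ext i; fin_cases i <;> simp
  open_source := isOpen_halfPlane
  open_target := isOpen_univ
  continuousOn_toFun := by
    refine continuousOn_pi.2 fun i => ?_
    fin_cases i
    · exact Real.continuousOn_log.comp (continuous_apply 0).continuousOn fun x hx => ne_of_gt hx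
    · exact (continuous_apply 1).continuousOn.add
        (hg.comp (continuous_apply 0).continuousOn fun x hx => hx)
  continuousOn_invFun := by
    refine continuousOn_pi.2 fun i => ?_
    have h : Continuous fun u : Plane => Real.exp (u 0) := by fun_prop
    fin_cases i
    · exact h.continuousOn
    · exact (continuous_apply 1).continuousOn.sub
        (hg.comp h.continuousOn fun u _ => Real.exp_pos _)

theorem isTypeA_of_coeffs_eq_zero {C : Christoffel} (hC : ∀ i j k, C i j k = C j i k)
    (hflat : ¬ (typeBConnection C hC).IsFlat)
    (h1 : C 0 1 0 = 0) (h2 : C 1 1 0 = 0) (h3 : C 1 1 1 = 0) :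
    (typeBConnection C hC).IsTypeA := by
  refine ⟨hflat, fun p hp => ?_⟩
  obtain ⟨g, g₁, hgs, hg⟩ := exists_shear_profile (C 0 0 0 - 2 * C 0 1 1) (C 0 0 1)
  refine ⟨logChart g hgs.continuousOn, hp, subset_rfl, ?_, ?_,
    ![![![1 + C 0 0 0, 0], ![0, C 0 1 1]], ![![0, C 0 1 1], ![0, 0]]], ?_⟩
  · refine contDiffOn_pi.2 fun i => ?_
    have h0 : ContDiffOn ℝ ∞ (fun x : Plane => x 0) halfPlane := (contDiff_apply ℝ ℝ 0).contDiffOn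
    fin_cases i
    · exact h0.log fun x hx => ne_of_gt hx
    · exact (contDiff_apply ℝ ℝ 1).contDiffOn.add (hgs.comp h0 fun x hx => hx)
  · refine contDiffOn_pi.2 fun i => ?_
    have h0 : ContDiff ℝ ∞ (fun u : Plane => Real.exp (u 0)) :=
      Real.contDiff_exp.comp (contDiff_apply ℝ ℝ 0)
    fin_cases i
    · exact h0.contDiffOn
    · exact (contDiff_apply ℝ ℝ 1).contDiffOn.sub
        (hgs.comp h0.contDiffOn fun u _ => Real.exp_pos _)
  · intro x hx
    change x ∈ halfPlane at hx
    have p0 : ∀ j, ∀ y ∈ halfPlane, pderiv j (fun y => logChart g hgs.continuousOn y 0) y =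
        (if j = 0 then (y 0)⁻¹ else 0) := fun j y hy =>
      pderiv_comp_fst (h := Real.log) (Real.hasDerivAt_log (ne_of_gt hy)) j
    have p1 : ∀ j, ∀ y ∈ halfPlane, pderiv j (fun y => logChart g hgs.continuousOn y 1) y =
        (if j = 0 then g₁ (y 0) else 1) := fun j y hy => by
      have hgy := (hg (y 0) hy).1
      have e : (fun y => logChart g hgs.continuousOn y 1) = fun y => y 1 + g (y 0) := rfl
      rw [e, pderiv_add (by fun_prop) (hasFDerivAt_comp_fst hgy).differentiableAt, pderiv_coord,
        pderiv_comp_fst hgy]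
      fin_cases j <;> simp
    have q0 : ∀ i j, pderiv i (pderiv j (fun y => logChart g hgs.continuousOn y 0)) x =
        if i = 0 then if j = 0 then -(x 0)⁻¹ ^ 2 else 0 else 0 := fun i j => by
      rw [pderiv_congr_of_eqOn isOpen_halfPlane (p0 j) hx]
      by_cases hj : j = 0
      · simp only [hj, if_true, pderiv_inv_fst hx]
      · simp only [hj, if_false, pderiv_const, ite_self]
    have q1 : ∀ i j, pderiv i (pderiv j (fun y => logChart g hgs.continuousOn y 1)) x =
        if i = 0 then if j = 0 then
          (x 0)⁻¹ * ((C 0 0 0 - 2 * C 0 1 1) * g₁ (x 0) + C 0 0 1)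
        else 0 else 0 := fun i j => by
      rw [pderiv_congr_of_eqOn isOpen_halfPlane (p1 j) hx]
      by_cases hj : j = 0
      · simp only [hj, if_true, pderiv_comp_fst (hg (x 0) hx).2]
      · simp only [hj, if_false, pderiv_const, ite_self]
    intro i j l
    fin_cases l <;> fin_cases i <;> fin_cases j <;>
      simp [Fin.sum_univ_two, p0 _ x hx, p1 _ x hx, q0, q1, typeBConnection, h1, h2, h3, hC 1 0] <;>
      ring

/-! ### Obstructions to charts with constant Christoffel symbols -/

/-- The bilinear form on `ℝ²` with matrix `r`. -/
def bilin (r : Fin 2 → Fin 2 → ℝ) (v w : Fin 2 → ℝ) : ℝ := ∑ a, ∑ b, r a b * v a * w b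

theorem bilin_comm {r : Fin 2 → Fin 2 → ℝ} (hr : r 0 1 = r 1 0) (v w : Fin 2 → ℝ) :
    bilin r v w = bilin r w v := by
  simp only [bilin, Fin.sum_univ_two, hr]
  ring

/-- A bilinear form on the plane in terms of its values on a frame `e, f`. -/
theorem bilin_mul_gram_det {r : Fin 2 → Fin 2 → ℝ} (hr : r 0 1 = r 1 0) (e f v w : Fin 2 → ℝ) :
    bilin r v w * (bilin r e e * bilin r f f - bilin r e f ^ 2) =
      bilin r f f * bilin r v e * bilin r w e
      - bilin r e f * (bilin r v e * bilin r w f + bilin r v f * bilin r w e)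
      + bilin r e e * bilin r v f * bilin r w f := by
  simp only [bilin, Fin.sum_univ_two, hr]
  ring

/-- A vector orthogonal to a frame `e, f` is in the radical. -/
theorem bilin_eq_zero_of_frame {r : Fin 2 → Fin 2 → ℝ} {e f v : Fin 2 → ℝ}
    (hd : e 0 * f 1 - e 1 * f 0 ≠ 0) (he : bilin r v e = 0) (hf : bilin r v f = 0)
    (w : Fin 2 → ℝ) : bilin r v w = 0 := by
  apply (mul_eq_zero.1 _).resolve_left hd
  simp only [bilin, Fin.sum_univ_two] at he hf ⊢
  linear_combination (w 0 * f 1 - w 1 * f 0) * he + (w 1 * e 0 - w 0 * e 1) * hf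

theorem pderiv_bilin {x : Plane} (r : Fin 2 → Fin 2 → ℝ) {F H : Fin 2 → Plane → ℝ}
    (hF : ∀ a, DifferentiableAt ℝ (F a) x) (hH : ∀ a, DifferentiableAt ℝ (H a) x) (i : Fin 2) :
    pderiv i (fun y => bilin r (fun a => F a y) (fun a => H a y)) x =
      bilin r (fun a => pderiv i (F a) x) (fun a => H a x)
      + bilin r (fun a => F a x) (fun a => pderiv i (H a) x) := by
  have f0 := hF 0
  have f1 := hF 1
  have g0 := hH 0
  have g1 := hH 1
  simp only [bilin, Fin.sum_univ_two]
  simp (disch := fun_prop) only [pderiv_add, pderiv_mul, pderiv_const]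
  ring

/-- The differential of a chart in which `∇^C` has the constant Christoffel symbols `G`: `J j a` is
the `j`-th partial derivative of the `a`-th coordinate function of the chart, and `hess` is the
transformation law of Christoffel symbols. -/
structure ConstantFrame (C G : Christoffel) (s : Set Plane) (J : Fin 2 → Fin 2 → Plane → ℝ) :
    Prop where
  isOpen : IsOpen s
  subset : s ⊆ halfPlane
  smooth : ∀ j a, ContDiffOn ℝ ∞ (J j a) s
  closed : ∀ x ∈ s, ∀ i j a, pderiv i (J j a) x = pderiv j (J i a) x
  det_ne : ∀ x ∈ s, J 0 0 x * J 1 1 x - J 0 1 x * J 1 0 x ≠ 0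
  hess : ∀ x ∈ s, ∀ i j a, pderiv i (J j a) x =
    (x 0)⁻¹ * ∑ k, C i j k * J k a x
      - bilin (fun b c => G b c a) (fun b => J i b x) (fun c => J j c x)

theorem constantFrame_of_chart {C : Christoffel} (hC : ∀ i j k, C i j k = C j i k)
    {φ : OpenPartialHomeomorph Plane Plane} (hs : φ.source ⊆ halfPlane)
    (h1 : ContDiffOn ℝ ∞ φ φ.source) (h2 : ContDiffOn ℝ ∞ φ.symm φ.target) {G : Christoffel}
    (hG : ∀ x ∈ φ.source, Intertwines φ x ((typeBConnection C hC).Γ x) G) :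
    ConstantFrame C G φ.source (fun j a => pderiv j (fun y => φ y a)) where
  isOpen := φ.open_source
  subset := hs
  smooth j a := contDiffOn_pderiv φ.open_source (contDiffOn_pi.1 h1 a) j
  closed x hx i j a := pderiv_comm φ.open_source (contDiffOn_pi.1 h1 a) hx i j
  det_ne x hx := by
    have d1 : DifferentiableAt ℝ φ x :=
      (h1.contDiffAt (φ.open_source.mem_nhds hx)).differentiableAt (by simp)
    have d2 : DifferentiableAt ℝ φ.symm (φ x) :=
      (h2.contDiffAt (φ.open_target.mem_nhds (φ.map_source hx))).differentiableAt (by simp)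
    have hcomp : (fderiv ℝ φ.symm (φ x)).comp (fderiv ℝ φ x) = ContinuousLinearMap.id ℝ Plane := by
      rw [← fderiv_comp x d2 d1, ← fderiv_id]
      exact Filter.EventuallyEq.fderiv_eq
        (Filter.eventually_of_mem (φ.open_source.mem_nhds hx) fun y hy => φ.left_inv hy)
    have hJ : ∀ j a, pderiv j (fun y => φ y a) x = fderiv ℝ φ x (Pi.single j 1) a := fun j a => by
      rw [pderiv, fderiv_apply d1]
      rfl
    have hv : ∀ v : Plane, fderiv ℝ φ.symm (φ x) v = v 0 • fderiv ℝ φ.symm (φ x) (Pi.single 0 1)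
        + v 1 • fderiv ℝ φ.symm (φ x) (Pi.single 1 1) := fun v => by
      rw [← map_smul, ← map_smul, ← map_add]
      congr 1
      ext i; fin_cases i <;> simp
    have e : ∀ j l, pderiv j (fun y => φ y 0) x * fderiv ℝ φ.symm (φ x) (Pi.single 0 1) l
        + pderiv j (fun y => φ y 1) x * fderiv ℝ φ.symm (φ x) (Pi.single 1 1) l
        = (Pi.single j 1 : Plane) l := fun j l => by
      have := congrFun (DFunLike.congr_fun hcomp (Pi.single j 1)) l
      rw [ContinuousLinearMap.comp_apply, hv] at this
      simpa [hJ] using this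
    intro h0
    have e00 := e 0 0
    have e01 := e 0 1
    have e10 := e 1 0
    have e11 := e 1 1
    simp only [Pi.single_eq_same, Pi.single_apply, Fin.isValue, one_ne_zero, zero_ne_one,
      if_false] at e00 e01 e10 e11
    refine one_ne_zero (α := ℝ) ?_
    set Q00 := fderiv ℝ φ.symm (φ x) (Pi.single 0 1) 0
    set Q01 := fderiv ℝ φ.symm (φ x) (Pi.single 0 1) 1
    set Q10 := fderiv ℝ φ.symm (φ x) (Pi.single 1 1) 0
    set Q11 := fderiv ℝ φ.symm (φ x) (Pi.single 1 1) 1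
    linear_combination (Q00 * Q11 - Q01 * Q10) * h0
      - (pderiv 1 (fun y => φ y 0) x * Q01 + pderiv 1 (fun y => φ y 1) x * Q11) * e00 - e11
      + (pderiv 1 (fun y => φ y 0) x * Q00 + pderiv 1 (fun y => φ y 1) x * Q10) * e01
  hess x hx i j a := by
    have := hG x hx i j a
    simp only [typeBConnection] at this
    rw [eq_sub_iff_add_eq, bilin, ← this, Finset.mul_sum]
    simp only [mul_assoc]

/-- The Ricci tensor of the connection on the plane with constant Christoffel symbols `G`. -/
def constRicci (G : Christoffel) (j k : Fin 2) : ℝ :=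
  ∑ i, ∑ m, (G i m i * G j k m - G j m i * G i k m)

namespace ConstantFrame

variable {C G : Christoffel} {s : Set Plane} {J : Fin 2 → Fin 2 → Plane → ℝ}

theorem differentiableAt (h : ConstantFrame C G s J) {x : Plane} (hx : x ∈ s) (j a : Fin 2) :
    DifferentiableAt ℝ (J j a) x :=
  differentiableAt_of_smoothOn h.isOpen (h.smooth j a) hx

theorem symm (h : ConstantFrame C G s J) (hC : ∀ i j k, C i j k = C j i k) (hs : s.Nonempty)
    (b c a : Fin 2) : G b c a = G c b a := by
  obtain ⟨x, hx⟩ := hs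
  suffices ∀ a, G 0 1 a = G 1 0 a by fin_cases b <;> fin_cases c <;> simp [this]
  intro a
  have e := h.closed x hx 0 1 a
  rw [h.hess x hx, h.hess x hx] at e
  simp only [bilin, Fin.sum_univ_two, hC 1 0] at e
  apply mul_left_cancel₀ (h.det_ne x hx)
  linear_combination -e

theorem hess_deriv (h : ConstantFrame C G s J) {x : Plane} (hx : x ∈ s) (l i j a : Fin 2) :
    pderiv l (pderiv i (J j a)) x =
      (if l = 0 then -(x 0)⁻¹ ^ 2 else 0) * ∑ k, C i j k * J k a x
      + (x 0)⁻¹ * ∑ k, C i j k * pderiv l (J k a) x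
      - (bilin (fun b c => G b c a) (fun b => pderiv l (J i b) x) (fun c => J j c x)
        + bilin (fun b c => G b c a) (fun b => J i b x) (fun c => pderiv l (J j c) x)) := by
  have d0 := differentiableAt_inv_fst (h.subset hx)
  have d1 := h.differentiableAt hx
  have f0 := d1 0 a
  have f1 := d1 1 a
  have d2 : DifferentiableAt ℝ (fun y =>
      bilin (fun b c => G b c a) (fun b => J i b y) (fun c => J j c y)) x := by
    have g0 := d1 i 0
    have g1 := d1 i 1
    have g2 := d1 j 0
    have g3 := d1 j 1
    simp only [bilin, Fin.sum_univ_two]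
    fun_prop
  rw [pderiv_congr_of_eqOn h.isOpen (fun y hy => h.hess y hy i j a) hx,
    pderiv_sub (by fun_prop) d2, pderiv_bilin (fun b c => G b c a) (d1 i) (d1 j)]
  simp only [Fin.sum_univ_two]
  simp (disch := fun_prop) only [pderiv_add, pderiv_mul, pderiv_const,
    pderiv_inv_fst (h.subset hx)]
  ring

/-- Commuting the second derivatives of `J` gives the transformation law of the curvature. -/
theorem curvature_eq (h : ConstantFrame C G s J)
    (hC : ∀ i j k, C i j k = C j i k) (hG : ∀ b c a, G b c a = G c b a)
    {x : Plane} (hx : x ∈ s) (j a : Fin 2) :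
    (x 0)⁻¹ ^ 2 * ∑ k, curvConst C 0 1 j k * J k a x =
      (J 0 0 x * J 1 1 x - J 0 1 x * J 1 0 x) *
        ∑ d, (∑ m, (G 0 m a * G 1 d m - G 1 m a * G 0 d m)) * J j d x := by
  have e : pderiv 1 (pderiv 0 (J j a)) x = pderiv 0 (pderiv 1 (J j a)) x :=
    pderiv_comm h.isOpen (h.smooth j a) hx 1 0
  rw [h.hess_deriv hx, h.hess_deriv hx] at e
  simp only [h.hess x hx, bilin, Fin.sum_univ_two, Fin.isValue, if_true, one_ne_zero, if_false,
    hG 1 0, hC 1 0, curvConst] at e ⊢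
  linear_combination -e

theorem ricci_eq (h : ConstantFrame C G s J)
    (hC : ∀ i j k, C i j k = C j i k) (hG : ∀ b c a, G b c a = G c b a)
    {x : Plane} (hx : x ∈ s) (j k : Fin 2) :
    bilin (constRicci G) (fun a => J j a x) (fun a => J k a x) =
      (x 0)⁻¹ ^ 2 * ricciConst C j k := by
  have e0 := h.curvature_eq hC hG hx k 0
  have e1 := h.curvature_eq hC hG hx k 1
  apply mul_left_cancel₀ (h.det_ne x hx)
  fin_cases j <;> fin_cases k <;>
    simp only [bilin, Fin.sum_univ_two, Fin.isValue, if_true, one_ne_zero, if_false, hG 1 0, hC 1 0,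
      curvConst, ricciConst, constRicci, Fin.zero_eta, Fin.mk_one] at e0 e1 ⊢
  · linear_combination J 0 0 x * e1 - J 0 1 x * e0
  · linear_combination J 0 0 x * e1 - J 0 1 x * e0
  · linear_combination J 1 0 x * e1 - J 1 1 x * e0
  · linear_combination J 1 0 x * e1 - J 1 1 x * e0

theorem ricci_deriv (h : ConstantFrame C G s J)
    (hC : ∀ i j k, C i j k = C j i k) (hG : ∀ b c a, G b c a = G c b a)
    {x : Plane} (hx : x ∈ s) (i j k : Fin 2) :
    bilin (constRicci G) (fun a => pderiv i (J j a) x) (fun a => J k a x)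
      + bilin (constRicci G) (fun a => J j a x) (fun a => pderiv i (J k a) x) =
      if i = 0 then -2 * (x 0)⁻¹ ^ 3 * ricciConst C j k else 0 := by
  have d0 := differentiableAt_inv_fst (h.subset hx)
  rw [← pderiv_bilin (constRicci G) (h.differentiableAt hx j) (h.differentiableAt hx k),
    pderiv_congr_of_eqOn h.isOpen (fun y hy => h.ricci_eq hC hG hy j k) hx]
  simp only [pow_two]
  simp (disch := fun_prop) only [pderiv_mul, pderiv_const, pderiv_inv_fst (h.subset hx)]
  split_ifs <;> ring

theorem constRicci_comm (hG : ∀ b c a, G b c a = G c b a) :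
    constRicci G 0 1 = constRicci G 1 0 := by
  simp only [constRicci, Fin.sum_univ_two, hG 1 0]
  ring

theorem ricciConst_comm (h : ConstantFrame C G s J) (hs : s.Nonempty)
    (hC : ∀ i j k, C i j k = C j i k) (hG : ∀ b c a, G b c a = G c b a) :
    ricciConst C 0 1 = ricciConst C 1 0 := by
  obtain ⟨x, hx⟩ := hs
  apply mul_left_cancel₀ (pow_ne_zero 2 (inv_ne_zero (ne_of_gt (h.subset hx))))
  rw [← h.ricci_eq hC hG hx, ← h.ricci_eq hC hG hx, bilin_comm (constRicci_comm hG)]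

/-- Constant Christoffel symbols `G` have symmetric Ricci tensor with totally symmetric covariant
derivative, and both properties are independent of coordinates. -/
theorem isCodazzi (h : ConstantFrame C G s J) (hs : s.Nonempty)
    (hC : ∀ i j k, C i j k = C j i k) (hG : ∀ b c a, G b c a = G c b a) : IsCodazzi C := by
  have hsymm := h.ricciConst_comm hs hC hG
  obtain ⟨x, hx⟩ := hs
  refine ⟨?_, fun k => ?_⟩
  · obtain ⟨-, h01, h10, -⟩ := ricciConst_formulas hC
    linear_combination hsymm - h01 + h10
  · have R := h.ricci_eq hC hG hx
    have D0 := h.ricci_deriv hC hG hx 0 1 k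
    have D1 := h.ricci_deriv hC hG hx 1 0 k
    apply (mul_eq_zero.1 _).resolve_left (pow_ne_zero 3 (inv_ne_zero (ne_of_gt (h.subset hx))))
    have R00 := R 0 0
    have R01 := R 0 1
    have R10 := R 1 0
    have R11 := R 1 1
    simp only [h.hess x hx, bilin, constRicci, Fin.sum_univ_two, Fin.isValue, if_true, one_ne_zero,
      if_false, hG 1 0, hC 1 0] at D0 D1 R00 R01 R10 R11 ⊢
    linear_combination D1 - D0 + (x 0)⁻¹ * (C 0 k 0 * R10 + C 0 k 1 * R11
      - C 1 k 0 * R00 - C 1 k 1 * R01)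

/-- If the Ricci tensor `r` of `G` is nondegenerate, it is a flat pseudometric, as its components in
the chart are constant, whereas `(x¹)⁻² ρ` with `ρ_{22} ≠ 0` is not flat. If `r` is degenerate, its
radical is parallel in the chart, which again contradicts `ρ_{22} ≠ 0`. -/
theorem ricciConst_one_one (h : ConstantFrame C G s J) (hs : s.Nonempty)
    (hC : ∀ i j k, C i j k = C j i k) (hG : ∀ b c a, G b c a = G c b a) :
    ricciConst C 1 1 = 0 := by
  have hr := constRicci_comm hG
  -- the Koszul formula for the pairings of second with first derivatives of the chart
  have koszul : ∀ y ∈ s,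
      bilin (constRicci G) (fun a => pderiv 1 (J 0 a) y) (fun a => J 0 a y) = 0 ∧
      bilin (constRicci G) (fun a => pderiv 1 (J 0 a) y) (fun a => J 1 a y) =
        -((y 0)⁻¹ ^ 3 * ricciConst C 1 1) ∧
      bilin (constRicci G) (fun a => pderiv 1 (J 1 a) y) (fun a => J 0 a y) =
        (y 0)⁻¹ ^ 3 * ricciConst C 1 1 ∧
      bilin (constRicci G) (fun a => pderiv 1 (J 1 a) y) (fun a => J 1 a y) = 0 ∧
      bilin (constRicci G) (fun a => pderiv 0 (J 0 a) y) (fun a => J 0 a y) =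
        -((y 0)⁻¹ ^ 3 * ricciConst C 0 0) ∧
      bilin (constRicci G) (fun a => pderiv 0 (J 0 a) y) (fun a => J 1 a y) =
        -(2 * (y 0)⁻¹ ^ 3 * ricciConst C 0 1) := by
    intro y hy
    have D := h.ricci_deriv hC hG hy
    have D000 := D 0 0 0
    have D001 := D 0 0 1
    have D011 := D 0 1 1
    have D100 := D 1 0 0
    have D101 := D 1 0 1
    have D111 := D 1 1 1
    simp only [bilin_comm hr (fun a => J _ a y), Fin.isValue, if_true, one_ne_zero, if_false,
      h.closed y hy 0 1] at D000 D001 D011 D100 D101 D111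
    refine ⟨?_, ?_, ?_, ?_, ?_, ?_⟩ <;> linarith
  obtain ⟨x, hx⟩ := hs
  obtain ⟨S100, S101, S110, S111, S000, S001⟩ := koszul x hx
  have R := h.ricci_eq hC hG hx
  have y0 : (x 0)⁻¹ ≠ 0 := inv_ne_zero (ne_of_gt (h.subset hx))
  have d0 := differentiableAt_inv_fst (h.subset hx)
  have dJ : ∀ i j a, DifferentiableAt ℝ (pderiv i (J j a)) x := fun i j a =>
    differentiableAt_of_smoothOn h.isOpen (contDiffOn_pderiv h.isOpen (h.smooth j a) i) hx
  have A : _ = pderiv 1 (fun _ => (0 : ℝ)) x :=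
    pderiv_congr_of_eqOn h.isOpen (fun y hy => (koszul y hy).1) hx 1
  rw [pderiv_bilin _ (dJ 1 0) (h.differentiableAt hx 0), pderiv_const] at A
  have B := pderiv_congr_of_eqOn h.isOpen (fun y hy => (koszul y hy).2.2.1) hx 0
  have e3 : pderiv 0 (fun y => (y 0)⁻¹ ^ 3 * ricciConst C 1 1) x =
      -(3 * (x 0)⁻¹ ^ 4 * ricciConst C 1 1) := by
    have : (fun y : Plane => (y 0)⁻¹ ^ 3 * ricciConst C 1 1) = fun y =>
      (y 0)⁻¹ * ((y 0)⁻¹ * ((y 0)⁻¹ * ricciConst C 1 1)) := by funext y; ring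
    rw [this]
    simp (disch := fun_prop) only [pderiv_mul, pderiv_const, pderiv_inv_fst (h.subset hx)]
    simp only [if_true]
    ring
  have e4 : ∀ a, pderiv 0 (pderiv 1 (J 1 a)) x = pderiv 1 (pderiv 1 (J 0 a)) x := fun a => by
    rw [pderiv_comm h.isOpen (h.smooth 1 a) hx]
    exact pderiv_congr_of_eqOn h.isOpen (fun y hy => h.closed y hy 0 1 a) hx 1
  rw [pderiv_bilin _ (dJ 1 1) (h.differentiableAt hx 0), e3] at B
  simp only [e4] at B
  -- differentiating two of these pairings once more eliminates the third derivatives of the chart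
  have gauss : bilin (constRicci G) (fun a => pderiv 1 (J 0 a) x) (fun a => pderiv 1 (J 0 a) x)
      - bilin (constRicci G) (fun a => pderiv 1 (J 1 a) x) (fun a => pderiv 0 (J 0 a) x)
      = 3 * (x 0)⁻¹ ^ 4 * ricciConst C 1 1 := by linarith
  -- multiplied by the determinant of `ρ`, the left side can be computed from `koszul`
  have g1 := bilin_mul_gram_det hr (fun a => J 0 a x) (fun a => J 1 a x)
    (fun a => pderiv 1 (J 0 a) x) (fun a => pderiv 1 (J 0 a) x)
  have g2 := bilin_mul_gram_det hr (fun a => J 0 a x) (fun a => J 1 a x)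
    (fun a => pderiv 1 (J 1 a) x) (fun a => pderiv 0 (J 0 a) x)
  simp only [R, S100, S101, S110, S111, S000, S001] at g1 g2
  have hdet : ricciConst C 1 1 = 0 ∨
      ricciConst C 0 0 * ricciConst C 1 1 - ricciConst C 0 1 ^ 2 = 0 := by
    rw [← mul_eq_zero]
    apply (mul_eq_zero.1 _).resolve_left (pow_ne_zero 8 y0)
    linear_combination g1 - g2 - gauss * ((x 0)⁻¹ ^ 4 *
      (ricciConst C 0 0 * ricciConst C 1 1 - ricciConst C 0 1 ^ 2))
  rcases hdet with h0 | h0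
  · exact h0
  · -- now `ρ_{22} ∂₁ - ρ_{12} ∂₂` is in the radical of `r`
    have K := bilin_eq_zero_of_frame (r := constRicci G) (e := fun a => J 0 a x)
      (f := fun a => J 1 a x)
      (v := fun a => ricciConst C 1 1 * J 0 a x - ricciConst C 0 1 * J 1 a x)
      (h.det_ne x hx)
    have hlin : ∀ w, bilin (constRicci G)
        (fun a => ricciConst C 1 1 * J 0 a x - ricciConst C 0 1 * J 1 a x) w =
        ricciConst C 1 1 * bilin (constRicci G) w (fun a => J 0 a x)
        - ricciConst C 0 1 * bilin (constRicci G) w (fun a => J 1 a x) := fun w => by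
      simp only [bilin, Fin.sum_univ_two, hr]; ring
    have hs := h.ricciConst_comm ⟨x, hx⟩ hC hG
    simp only [hlin, R] at K
    have K' := K (by linear_combination (x 0)⁻¹ ^ 2 * h0) (by rw [← hs]; ring)
      (fun a => pderiv 1 (J 1 a) x)
    rw [S110, S111] at K'
    have : (x 0)⁻¹ ^ 3 * ricciConst C 1 1 ^ 2 = 0 := by linear_combination K'
    exact pow_eq_zero_iff two_ne_zero |>.1
      ((mul_eq_zero.1 this).resolve_left (pow_ne_zero 3 y0))

end ConstantFrame

theorem coeffs_eq_zero_of_isTypeA {C : Christoffel} (hC : ∀ i j k, C i j k = C j i k)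
    (h : (typeBConnection C hC).IsTypeA) : C 0 1 0 = 0 ∧ C 1 1 0 = 0 ∧ C 1 1 1 = 0 := by
  obtain ⟨hflat, hcharts⟩ := h
  have hx : (fun _ => 1 : Plane) ∈ halfPlane := by simp [halfPlane]
  obtain ⟨φ, hp, hsub, h1, h2, G, hφ⟩ := hcharts _ hx
  have hJ := constantFrame_of_chart hC hsub h1 h2 hφ
  have hG := hJ.symm hC ⟨_, hp⟩
  have hcod := hJ.isCodazzi ⟨_, hp⟩ hC hG
  have hG0 : C 1 1 0 = 0 := by
    by_contra h0
    exact hflat ((isFlat_typeBConnection_iff C hC).2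
      (hcod.flat_of_ricci hC h0 (hJ.ricciConst_one_one ⟨_, hp⟩ hC hG)))
  obtain ⟨e1, e2⟩ := hcod.coeffs_eq_zero hC hG0
  exact ⟨e1, hG0, e2⟩

/-! ### Characterization of strong projective flatness -/

theorem theorem1p13 (M : TypeBSurface) :
    (M.connection.IsStronglyProjectivelyFlat ↔
      ∃ N : TypeBSurface, M.LinearlyEquivalent N ∧
        ((N.C 0 1 0 = 0 ∧ N.C 1 1 0 = 0 ∧ N.C 1 1 1 = 0) ∨
          ∃ v : ℝ, N.C 0 0 0 = 1 + 2 * v ∧ N.C 0 0 1 = 0 ∧ N.C 0 1 0 = 0 ∧ N.C 0 1 1 = v ∧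
            (N.C 1 1 0 = 1 ∨ N.C 1 1 0 = -1) ∧ N.C 1 1 1 = 0)) ∧
    ((M.C 0 1 0 = 0 ∧ M.C 1 1 0 = 0 ∧ M.C 1 1 1 = 0) ↔ M.connection.IsTypeA) := by
  refine ⟨⟨fun h => ?_, fun ⟨N, hMN, hN⟩ =>
    TypeBSurface.isStronglyProjectivelyFlat_of_linearlyEquivalent hMN hN⟩,
    fun ⟨h1, h2, h3⟩ => isTypeA_of_coeffs_eq_zero M.symm M.not_flat h1 h2 h3,
    coeffs_eq_zero_of_isTypeA M.symm⟩
  have hcod := IsCodazzi.of_isStronglyProjectivelyFlat M.symm h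
  by_cases hG : M.C 1 1 0 = 0
  · obtain ⟨h1, h3⟩ := hcod.coeffs_eq_zero M.symm hG
    exact ⟨M, M.linearlyEquivalent_refl, Or.inl ⟨h1, hG, h3⟩⟩
  · obtain ⟨N, hMN, hN⟩ := M.exists_linearlyEquivalent_paraboloid hcod hG
    exact ⟨N, hMN, Or.inr hN⟩
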